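/- Let $p,q\ge 0$ be integers with $n=p+q\ge 1$, and let ${\cal C}\ell_{p,q}$ be the real Clifford algebra with generators $e_1,\dots,e_n$ and identity $1$, where $e_ae_b+e_be_a=2\eta_{ab}$ and $\eta=\mathrm{diag}(1,\dots,1,-1,\dots,-1)$ with $p$ entries $1$ and $q$ entries $-1$. For $U\in{\cal C}\ell_{p,q}$ let $\langle U\rangle_0\in\mathbb R$ be the scalar part of $U$, i.e. its coefficient at $1$ in the basis of the products $e_{a_1}\cdots e_{a_k}$, $a_1<\dots<a_k$. Scalars are identified with multiples of $1$. Put $N=2^{[(n+1)/2]}$, an even number. Let $\beta$ be any isomorphism of complex algebras from $\mathbb C\otimes{\cal C}\ell_{p,q}$ onto $\mathrm{Mat}(2^{n/2},\mathbb C)$ if $n$ is even, and onto $\mathrm{Mat}(2^{(n-1)/2},\mathbb C)\oplus\mathrm{Mat}(2^{(n-1)/2},\mathbb C)$ if $n$ is odd; such isomorphisms exist. For $U\in{\cal C}\ell_{p,q}$ regard $\beta(U)=\beta(1\otimes U)$ as a complex $N\times N$ matrix (block diagonal with two blocks if $n$ is odd). Let $\mathrm{Det}(U)=\det\beta(U)$.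 The characteristic polynomial coefficients of $U$ are the numbers $c_1,\dots,c_N$ with $$\det(\lambda I_N-\beta(U))=\lambda^N-c_1\lambda^{N-1}-\cdots-c_{N-1}\lambda-c_N .$$ The adjugate $\mathrm{Adj}(U)$ is the element of ${\cal C}\ell_{p,q}$ with $\beta(\mathrm{Adj}(U))=\mathrm{adj}(\beta(U))$ and $\mathrm{Adj}(U)\,U=U\,\mathrm{Adj}(U)=\mathrm{Det}(U)\in\mathbb R$. For $U\in{\cal C}\ell_{p,q}$ define $$U_{(1)}=U,\qquad U_{(k+1)}=U\,(U_{(k)}-C_{(k)}),\qquad C_{(k)}=\frac Nk\langle U_{(k)}\rangle_0\in\mathbb R,\qquad k=1,\dots,N .$$ **Theorem.** For every such $\beta$ and every $U\in{\cal C}\ell_{p,q}$: 1. $C_{(1)},\dots,C_{(N)}$ are the characteristic polynomial coefficients of $U$, i.e. $c_k=C_{(k)}$ for $1\le k\le N$. Moreover $$\mathrm{Det}(U)=-C_{(N)}=-U_{(N)}=U\,(C_{(N-1)}-U_{(N-1)})\in\mathbb R .$$ The adjugate exists, and it is $\mathrm{Adj}(U)=C_{(N-1)}-U_{(N-1)}$.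 In particular these quantities do not depend on $\beta$. 2. With the scalars $S_{(k)}=(-1)^{k-1}N\,(k-1)!\,\langle U^k\rangle_0$, $k=1,\dots,N$, $$C_{(k)}=\frac{(-1)^{k+1}}{k!}B_k(S_{(1)},\dots,S_{(k)}),\quad 1\le k\le N,\qquad \mathrm{Det}(U)=-C_{(N)}=\frac1{N!}B_N(S_{(1)},\dots,S_{(N)}),$$ $$\mathrm{Adj}(U)=\sum_{k=0}^{N-1}\frac{(-1)^{N+k-1}}{k!}\,U^{N-k-1}B_k(S_{(1)},\dots,S_{(k)}).$$ Here $B_0=1$ and, for $k\ge1$, $B_k$ is the complete Bell polynomial $$B_k(x_1,\dots,x_k)=\sum_{i=1}^k\ \sum\frac{k!}{j_1!\cdots j_{k-i+1}!}\Big(\frac{x_1}{1!}\Big)^{j_1}\cdots\Big(\frac{x_{k-i+1}}{(k-i+1)!}\Big)^{j_{k-i+1}},$$ where the inner sum is over all nonnegative integers $j_1,\dots,j_{k-i+1}$ with $j_1+\dots+j_{k-i+1}=i$ and $j_1+2j_2+\dots+(k-i+1)j_{k-i+1}=k$. Equivalently, for all real $x_1,\dots,x_k$, $B_k(x_1,\dots,x_k)$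 is the determinant of the $k\times k$ matrix whose $(r,c)$ entry is $\binom{k-r}{c-r}x_{c-r+1}$ for $r\le c$, $-1$ for $r=c+1$, and $0$ for $r>c+1$; this equality of the two descriptions is part of the assertion. -/

import Mathlib

open scoped TensorProduct Nat

noncomputable section

namespace Clifford

/-- The quadratic form `x₁² + ⋯ + x_p² - x_{p+1}² - ⋯ - x_{p+q}²` on `ℝ^{p+q}`. -/
def form (p q : ℕ) : QuadraticForm ℝ (Fin (p + q) → ℝ) :=
  QuadraticMap.weightedSumSquares ℝ (fun a : Fin (p + q) => if a.val < p then (1 : ℝ) else -1)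

/-- The real Clifford algebra `Cl_{p,q}`. -/
abbrev Cl (p q : ℕ) : Type := CliffordAlgebra (form p q)

/-- The generator `e_a` of `Cl_{p,q}`. -/
def gen (p q : ℕ) (a : Fin (p + q)) : Cl p q :=
  CliffordAlgebra.ι (form p q) (Pi.single a 1)

/-- The basis element `e_{a₁} ⋯ e_{a_k}`, where `a₁ < ⋯ < a_k` are the elements of `A`. -/
def basisElt (p q : ℕ) (A : Finset (Fin (p + q))) : Cl p q :=
  ((A.sort (· ≤ ·)).map (gen p q)).prod

/-- The scalar part `⟨U⟩₀`: the projection onto grade `0`, as a real number. The grading is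
carried over from the exterior algebra by the canonical linear isomorphism, under which
`e_{a₁} ⋯ e_{a_k}`, `a₁ < ⋯ < a_k`, corresponds to `e_{a₁} ∧ ⋯ ∧ e_{a_k}`; the lemma
`scalarPart_basisElt` below gives the values on the standard basis. -/
def scalarPart (p q : ℕ) : Cl p q →ₗ[ℝ] ℝ :=
  (ExteriorAlgebra.algebraMapInv (R := ℝ) (M := Fin (p + q) → ℝ)).toLinearMap ∘ₗ
    (CliffordAlgebra.equivExterior (form p q)).toLinearMap

/-- The size `N = 2^{[(n+1)/2]}`, `n = p + q`. -/
def dimN (p q : ℕ) : ℕ := 2 ^ ((p + q + 1) / 2)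

/-- `Mat(2^{n/2}, ℂ)` for even `n` (a family with one member), and
`Mat(2^{(n-1)/2}, ℂ) ⊕ Mat(2^{(n-1)/2}, ℂ)` for odd `n` (a family with two members). -/
abbrev MatAlg (n : ℕ) : Type :=
  Fin (n % 2 + 1) → Matrix (Fin (2 ^ (n / 2))) (Fin (2 ^ (n / 2))) ℂ

/-- The representations `β`: isomorphisms of complex algebras from the complexified Clifford
algebra onto `MatAlg n`. -/
abbrev Rep (p q : ℕ) : Type := (ℂ ⊗[ℝ] Cl p q) ≃ₐ[ℂ] MatAlg (p + q)

variable {p q : ℕ}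

/-- The matrix `β(U)`, of size `N`: the only block for even `n`, the block diagonal matrix
of the two blocks for odd `n`. -/
def Rep.mat (β : Rep p q) (U : Cl p q) :
    Matrix (Fin (2 ^ ((p + q) / 2)) × Fin ((p + q) % 2 + 1))
      (Fin (2 ^ ((p + q) / 2)) × Fin ((p + q) % 2 + 1)) ℂ :=
  Matrix.blockDiagonal (β ((1 : ℂ) ⊗ₜ[ℝ] U))

/-- `Det(U) = det β(U)`. -/
def Rep.Det (β : Rep p q) (U : Cl p q) : ℂ := (β.mat U).det

/-- The `k`-th characteristic polynomial coefficient of `U`, `1 ≤ k ≤ N`, where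
`det (λ I - β(U)) = λ^N - C₁ λ^{N-1} - ⋯ - C_N`. -/
def Rep.charCoeff (β : Rep p q) (U : Cl p q) (k : ℕ) : ℂ :=
  -(β.mat U).charpoly.coeff (dimN p q - k)

/-- `A` is the adjugate of `U`: its matrix is the adjugate of the matrix of `U`, and
`A U = U A = Det(U)`, a real scalar. -/
def Rep.IsAdj (β : Rep p q) (U A : Cl p q) : Prop :=
  β.mat A = (β.mat U).adjugate ∧
    ∃ d : ℝ, (d : ℂ) = β.Det U ∧ A * U = algebraMap ℝ (Cl p q) d ∧
      U * A = algebraMap ℝ (Cl p q) d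

theorem Rep.mat_injective (β : Rep p q) : Function.Injective β.mat := by
  intro A B h
  have h1 := β.injective (Matrix.blockDiagonal_injective h)
  exact Algebra.TensorProduct.includeRight_injective (R := ℝ) (A := ℂ) (B := Cl p q)
    (algebraMap ℝ ℂ).injective h1

/-- The adjugate is unique. -/
theorem Rep.IsAdj.unique {β : Rep p q} {U A B : Cl p q} (hA : β.IsAdj U A)
    (hB : β.IsAdj U B) : A = B :=
  β.mat_injective (hA.1.trans hB.1.symm)

/-- The elements `U_{(k)}`, `k ≥ 1` (the value at `k = 0` is a placeholder):
`U_{(1)} = U`, `U_{(k+1)} = U (U_{(k)} - (N/k) ⟨U_{(k)}⟩₀)`. -/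
def seqU (U : Cl p q) : ℕ → Cl p q
  | 0 => 0
  | 1 => U
  | k + 2 => U * (seqU U (k + 1) -
      algebraMap ℝ (Cl p q) ((dimN p q : ℝ) / ((k + 1 : ℕ) : ℝ) *
        scalarPart p q (seqU U (k + 1))))

/-- The scalars `C_{(k)} = (N/k) ⟨U_{(k)}⟩₀`, `k ≥ 1`. -/
def seqC (U : Cl p q) (k : ℕ) : ℝ :=
  (dimN p q : ℝ) / (k : ℝ) * scalarPart p q (seqU U k)

/-- The scalars `S_{(k)} = (-1)^{k-1} N (k-1)! ⟨U^k⟩₀`, `k ≥ 1`. -/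
def seqS (U : Cl p q) (k : ℕ) : ℝ :=
  (-1) ^ (k - 1) * (dimN p q : ℝ) * ((k - 1)! : ℝ) * scalarPart p q (U ^ k)

/-- The complete Bell polynomial `B_k(x₁, …, x_k)`, with `B_0 = 1`. In the inner sum, `j m`
is the exponent of `x_{m+1}`. -/
def bell (k : ℕ) (x : ℕ → ℝ) : ℝ :=
  if k = 0 then 1 else
    ∑ i ∈ Finset.Icc 1 k,
      ∑ j ∈ ((Finset.univ : Finset (Fin (k - i + 1))).piAntidiag i).filter
          (fun j => ∑ m, (m.val + 1) * j m = k),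
        (k ! : ℝ) / (∏ m, ((j m)! : ℝ)) * ∏ m, (x (m.val + 1) / ((m.val + 1)! : ℝ)) ^ j m

/-- The `k × k` matrix with rows `(x₁, C(k-1,1) x₂, C(k-1,2) x₃, …, x_k)`,
`(-1, x₁, C(k-2,1) x₂, …, x_{k-1})`, …, `(0, …, 0, -1, x₁)`. -/
def bellMatrix (k : ℕ) (x : ℕ → ℝ) : Matrix (Fin k) (Fin k) ℝ :=
  Matrix.of fun r c =>
    if r.val ≤ c.val then
      ((k - 1 - r.val).choose (c.val - r.val) : ℝ) * x (c.val - r.val + 1)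
    else if r.val = c.val + 1 then -1 else 0

theorem gen_mul_self (a : Fin (p + q)) :
    gen p q a * gen p q a = algebraMap ℝ (Cl p q) (if a.val < p then 1 else -1) := by
  rw [gen, CliffordAlgebra.ι_sq_scalar]
  congr 1
  rw [form, QuadraticMap.weightedSumSquares_apply, Finset.sum_eq_single a]
  · simp
  · intro b _ hb
    simp [hb]
  · simp

theorem isOrtho_single {a b : Fin (p + q)} (h : a ≠ b) :
    QuadraticMap.associated (R := ℝ) (form p q) (Pi.single a 1) (Pi.single b 1) = 0 := by
  rw [QuadraticMap.associated_apply]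
  have : form p q (Pi.single a 1 + Pi.single b 1) - form p q (Pi.single a 1)
      - form p q (Pi.single b 1) = 0 := by
    simp only [form, QuadraticMap.weightedSumSquares_apply, ← Finset.sum_sub_distrib]
    refine Finset.sum_eq_zero fun i _ => ?_
    by_cases h1 : i = a
    · subst h1
      simp [h]
    · simp [Pi.single_apply, h1]
  rw [this]; simp

theorem gen_anticomm {a b : Fin (p + q)} (h : a ≠ b) :
    gen p q a * gen p q b + gen p q b * gen p q a = 0 := by
  refine CliffordAlgebra.ι_mul_ι_add_swap_of_isOrtho ?_
  rw [← QuadraticMap.associated_isOrtho (R := ℝ)]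
  exact isOrtho_single h

theorem contract_prod (a : Fin (p + q)) (l : List (Fin (p + q))) (hl : a ∉ l) :
    CliffordAlgebra.contractLeft (Q := (0 : QuadraticForm ℝ (Fin (p + q) → ℝ)))
      (QuadraticMap.associated (R := ℝ) (-form p q) (Pi.single a 1))
      ((l.map fun b => CliffordAlgebra.ι 0 (Pi.single b 1)).prod) = 0 := by
  induction l with
  | nil => simp
  | cons b l ih =>
    simp only [List.mem_cons, not_or] at hl
    rw [List.map_cons, List.prod_cons, CliffordAlgebra.contractLeft_ι_mul, ih hl.2]
    simp [isOrtho_single hl.1]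

theorem equivExterior_prod (l : List (Fin (p + q))) (hl : l.Nodup) :
    CliffordAlgebra.equivExterior (form p q) ((l.map (gen p q)).prod) =
      (l.map fun b => CliffordAlgebra.ι 0 (Pi.single b 1)).prod := by
  induction l with
  | nil => simp [CliffordAlgebra.equivExterior, CliffordAlgebra.changeFormEquiv]
  | cons a l ih =>
    have h := List.nodup_cons.1 hl
    have ih' := ih h.2
    simp only [CliffordAlgebra.equivExterior, CliffordAlgebra.changeFormEquiv_apply] at ih' ⊢
    rw [List.map_cons, List.prod_cons, List.map_cons, List.prod_cons, gen,
      CliffordAlgebra.changeForm_ι_mul, ih', contract_prod a l h.1, sub_zero]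

/-- The scalar part is the coefficient at the identity element in the standard basis. -/
theorem scalarPart_basisElt (A : Finset (Fin (p + q))) :
    scalarPart p q (basisElt p q A) = if A = ∅ then 1 else 0 := by
  have h : scalarPart p q (basisElt p q A) = ExteriorAlgebra.algebraMapInv
      (((A.sort (· ≤ ·)).map fun b =>
        ExteriorAlgebra.ι ℝ (Pi.single b 1 : Fin (p + q) → ℝ)).prod) := by
    have := equivExterior_prod (A.sort (· ≤ ·)) (A.sort_nodup (· ≤ ·))
    exact congrArg ExteriorAlgebra.algebraMapInv this
  rw [h, map_list_prod, List.map_map]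
  split_ifs with hA
  · subst hA; simp
  · obtain ⟨a, ha⟩ := Finset.nonempty_iff_ne_empty.2 hA
    refine List.prod_eq_zero (List.mem_map.2 ⟨a, by simpa using ha, ?_⟩)
    simp [ExteriorAlgebra.algebraMapInv]

end Clifford

end

/-! The recursion is the Faddeev–LeVerrier algorithm, with `N⟨U⟩₀` in place of the trace. For a
matrix `M` with characteristic polynomial `χ`, the Horner scheme `H₀ = 1`, `H_{i+1} = M H_i +
a_{N-i-1}` (where `a_j` is the coefficient of `λ^j` in `χ`) gives `adj(λ - M) = ∑ λ^{N-1-i} H_i`.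
Since `χ' = tr adj(λ - M)`, this yields `tr H_i = (N - i) a_{N-i}`, and hence `(i+1) a_{N-i-1} =
-tr(M H_i)`.

The link with the Clifford algebra is `tr β(U) = N⟨U⟩₀` (`Rep.trace_mat`). It suffices that nonempty
basis products have trace zero: each anticommutes with some generator, except the full product for
odd `n`, whose two blocks are opposite scalars. By induction `β(U_{(k+1)}) = M H_k` and `C_{(k+1)} =
-a_{N-k-1}` (`Rep.mat_seqU`). As `N` is even, `Det U = -C_{(N)}` and `adj M = -H_{N-1}`, which is
the image of `C_{(N-1)} - U_{(N-1)}`.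

The Bell formulas are Newton's identities: the scalar part of the unrolled recursion has the form of
`bell_succ`, a recursion that the determinants satisfy as well. Representations exist because the
target algebra has Clifford generators and the right dimension. -/

noncomputable section

/-! ### Horner scheme, adjugate and derivative of the characteristic polynomial -/

namespace Matrix

open Polynomial

variable {m R K : Type*} [Fintype m] [DecidableEq m] [CommRing R] [Field K]

/-- The matrix coefficients of `adj (λ - M)`: the Horner scheme for the characteristic polynomial
of `M`, evaluated at `M`. -/
def charpolyHorner (M : Matrix m m R) : ℕ → Matrix m m R
  | 0 => 1
  | i + 1 => M * charpolyHorner M i + M.charpoly.coeff (Fintype.card m - (i + 1)) • 1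

theorem charpolyHorner_succ (M : Matrix m m R) (i : ℕ) :
    M.charpolyHorner (i + 1) =
      M * M.charpolyHorner i + M.charpoly.coeff (Fintype.card m - (i + 1)) • 1 := rfl

theorem charpolyHorner_eq_sum [Nontrivial R] (M : Matrix m m R) {i : ℕ} (hi : i ≤ Fintype.card m) :
    M.charpolyHorner i =
      ∑ j ∈ Finset.range (i + 1), M.charpoly.coeff (Fintype.card m - i + j) • M ^ j := by
  induction i with
  | zero =>
    have h := M.charpoly_monic.coeff_natDegree
    rw [charpoly_natDegree_eq_dim] at h
    simp [charpolyHorner, h]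
  | succ i ih =>
    rw [charpolyHorner_succ, ih (by omega), Finset.sum_range_succ' _ (i + 1), Finset.mul_sum]
    congr 1
    refine Finset.sum_congr rfl fun j _ => ?_
    rw [mul_smul_comm, pow_succ']
    congr 2
    omega

/-- At the last index the Horner sum is the whole characteristic polynomial at `M`, so this is
Cayley–Hamilton. -/
theorem charpolyHorner_card [Nontrivial R] (M : Matrix m m R) :
    M.charpolyHorner (Fintype.card m) = 0 := by
  rw [charpolyHorner_eq_sum M le_rfl, ← aeval_self_charpoly M, aeval_eq_sum_range,
    charpoly_natDegree_eq_dim]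
  simp

/-- The product telescopes; the remainder `t ^ (N - k) • H_k` disappears at `k = N` by
Cayley–Hamilton. -/
theorem sub_mul_sum_charpolyHorner [Nontrivial R] (M : Matrix m m R) (t : R) :
    (scalar m t - M) * ∑ i ∈ Finset.range (Fintype.card m),
      t ^ (Fintype.card m - 1 - i) • M.charpolyHorner i = M.charpoly.eval t • 1 := by
  set N := Fintype.card m with hN
  have key : ∀ k ≤ N, (scalar m t - M) * ∑ i ∈ Finset.range k,
      t ^ (N - 1 - i) • M.charpolyHorner i =
      (∑ i ∈ Finset.range (k + 1), t ^ (N - i) * M.charpoly.coeff (N - i)) • (1 : Matrix m m R)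
        - t ^ (N - k) • M.charpolyHorner k := by
    intro k hk
    induction k with
    | zero =>
      have h := M.charpoly_monic.coeff_natDegree
      rw [charpoly_natDegree_eq_dim] at h
      simp [charpolyHorner, hN, h]
    | succ k ih =>
      rw [Finset.sum_range_succ, mul_add, ih (by omega), Finset.sum_range_succ _ (k + 1),
        charpolyHorner_succ, ← hN, sub_mul, scalar_apply, ← smul_eq_diagonal_mul,
        mul_smul_comm, add_smul, smul_add, smul_smul, smul_smul, ← pow_succ']
      have h1 : N - 1 - k + 1 = N - k := by omega
      have h2 : N - 1 - k = N - (k + 1) := by omega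
      rw [h1, h2]
      abel
  rw [key N le_rfl, hN, charpolyHorner_card, smul_zero, sub_zero]
  congr 1
  rw [eval_eq_sum_range, charpoly_natDegree_eq_dim, ← Finset.sum_range_reflect]
  refine Finset.sum_congr rfl fun i hi => ?_
  rw [mul_comm]
  congr 2 <;> grind

theorem adjugate_sub_eq_sum_charpolyHorner (M : Matrix m m K) {t : K}
    (ht : M.charpoly.eval t ≠ 0) :
    (scalar m t - M).adjugate = ∑ i ∈ Finset.range (Fintype.card m),
      t ^ (Fintype.card m - 1 - i) • M.charpolyHorner i := by
  have h := congrArg ((scalar m t - M).adjugate * ·) (sub_mul_sum_charpolyHorner M t)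
  simp only [← mul_assoc, adjugate_mul, ← eval_charpoly] at h
  rw [smul_mul_assoc, one_mul, mul_smul_comm, mul_one] at h
  exact (smul_right_injective _ ht h).symm

/-- Jacobi's formula: with `A = t - M` invertible, `χ(t + s) = det A · det(1 + s A⁻¹)` has
derivative `det A · tr A⁻¹` at `s = 0`. -/
theorem derivative_charpoly_eval [Infinite K] (M : Matrix m m K) {t : K} (ht : M.charpoly.eval t ≠ 0) :
    (derivative M.charpoly).eval t = (scalar m t - M).adjugate.trace := by
  set A := scalar m t - M with hA
  have hd : A.det ≠ 0 := by rwa [hA, ← eval_charpoly]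
  have h1 : M.charpoly.comp (X + C t) = C A.det * det (1 + (X : K[X]) • A⁻¹.map C) := by
    refine Polynomial.funext fun s => ?_
    have h3 : (det (1 + (X : K[X]) • A⁻¹.map C)).eval s = det (1 + s • A⁻¹) := by
      rw [← coe_evalRingHom, RingHom.map_det]
      congr 1
      ext i j
      by_cases hij : i = j <;> simp [hij, mul_comm s]
    rw [eval_comp, eval_charpoly, eval_mul, eval_C, h3, ← det_mul, mul_add, mul_one,
      mul_smul_comm, mul_nonsing_inv _ (isUnit_iff_ne_zero.2 hd), hA]
    congr 1
    simp only [eval_add, eval_X, eval_C, map_add, scalar_apply, smul_one_eq_diagonal]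
    abel
  have h2 := congrArg (fun p => (derivative p).eval 0) h1
  simp only [derivative_comp, eval_mul, eval_comp, derivative_mul, derivative_C, zero_mul, zero_add,
    eval_C, derivative_det_one_add_X_smul] at h2
  simp at h2
  rw [h2, inv_def, trace_smul]
  simp [hd]

theorem trace_charpolyHorner [Infinite K] (M : Matrix m m K) {i : ℕ} (hi : i ≤ Fintype.card m) :
    (M.charpolyHorner i).trace =
      ((Fintype.card m - i : ℕ) : K) * M.charpoly.coeff (Fintype.card m - i) := by
  rcases hi.eq_or_lt with rfl | hi
  · simp [charpolyHorner_card]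
  have h : derivative M.charpoly = ∑ i ∈ Finset.range (Fintype.card m),
      C (M.charpolyHorner i).trace * X ^ (Fintype.card m - 1 - i) := by
    -- After multiplication by `χ` both sides vanish at its roots, so only `t` with `t - M`
    -- invertible need be checked.
    refine mul_left_cancel₀ M.charpoly_monic.ne_zero (Polynomial.funext fun t => ?_)
    rw [eval_mul, eval_mul]
    rcases eq_or_ne (M.charpoly.eval t) 0 with ht | ht
    · rw [ht, zero_mul, zero_mul]
    · rw [derivative_charpoly_eval M ht, adjugate_sub_eq_sum_charpolyHorner M ht, trace_sum,
        eval_finsetSum]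
      congr 1
      refine Finset.sum_congr rfl fun i _ => ?_
      rw [trace_smul, smul_eq_mul, eval_mul, eval_C, eval_pow, eval_X, mul_comm]
  have h2 := congrArg (fun p => coeff p (Fintype.card m - 1 - i)) h
  simp only [coeff_derivative, finsetSum_coeff, coeff_C_mul_X_pow] at h2
  rw [Finset.sum_eq_single i (fun b hb hbi => if_neg (by grind)) (by simp [hi]), if_pos rfl] at h2
  rw [← h2, show Fintype.card m - i = Fintype.card m - 1 - i + 1 by omega]
  push_cast
  ring

/-- The formula for `adj(t - M)` is wanted at `t = 0`, possibly a root of `χ`, so it is first proved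
as a polynomial identity for each entry. -/
theorem adjugate_neg_eq_charpolyHorner [Infinite K] [Nonempty m] (M : Matrix m m K) :
    (-M).adjugate = M.charpolyHorner (Fintype.card m - 1) := by
  have hN : 0 < Fintype.card m := Fintype.card_pos
  ext a b
  have h : (charmatrix M).adjugate a b = ∑ i ∈ Finset.range (Fintype.card m),
      C (M.charpolyHorner i a b) * X ^ (Fintype.card m - 1 - i) := by
    refine mul_left_cancel₀ M.charpoly_monic.ne_zero (Polynomial.funext fun t => ?_)
    rw [eval_mul, eval_mul]
    rcases eq_or_ne (M.charpoly.eval t) 0 with ht | ht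
    · rw [ht, zero_mul, zero_mul]
    · have h1 : ((charmatrix M).adjugate a b).eval t = (scalar m t - M).adjugate a b := by
        have := (evalRingHom t).map_adjugate (charmatrix M)
        have h3 : (evalRingHom t).mapMatrix (charmatrix M) = scalar m t - M := by
          ext i j
          by_cases hij : i = j <;> simp [hij]
        rw [h3] at this
        rw [← this]; rfl
      rw [h1, adjugate_sub_eq_sum_charpolyHorner M ht, sum_apply, eval_finsetSum]
      congr 1
      refine Finset.sum_congr rfl fun i _ => ?_
      rw [smul_apply, smul_eq_mul, eval_mul, eval_C, eval_pow, eval_X, mul_comm]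
  have h3 : ((charmatrix M).adjugate a b).eval 0 = (-M).adjugate a b := by
    have := (evalRingHom (0 : K)).map_adjugate (charmatrix M)
    have h3 : (evalRingHom (0 : K)).mapMatrix (charmatrix M) = -M := by
      ext i j
      by_cases hij : i = j <;> simp [hij]
    rw [h3] at this
    rw [← this]; rfl
  rw [← h3, h, eval_finsetSum, Finset.sum_eq_single (Fintype.card m - 1)]
  · simp
  · intro i hi hne
    have : Fintype.card m - 1 - i ≠ 0 := by grind
    simp [this]
  · simp [hN]

end Matrix

/-! ### Complete Bell polynomials: recursion and determinant -/

namespace Clifford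

/-- The `j : Fin K → ℕ` with `∑ (m + 1) j m = k`: the partitions of `k` into parts at most `K`,
`j m` being the multiplicity of `m + 1`. -/
def multiplicities (K k : ℕ) : Finset (Fin K → ℕ) :=
  (Fintype.piFinset fun _ => Finset.range (k + 1)).filter fun j => ∑ m, (m.val + 1) * j m = k

theorem mem_multiplicities {K k : ℕ} {j : Fin K → ℕ} :
    j ∈ multiplicities K k ↔ ∑ m, (m.val + 1) * j m = k := by
  rw [multiplicities, Finset.mem_filter, Fintype.mem_piFinset, and_iff_right_iff_imp]
  intro h m
  have := Finset.single_le_sum (f := fun m : Fin K => (m.val + 1) * j m)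
    (fun _ _ => Nat.zero_le _) (Finset.mem_univ m)
  rw [Finset.mem_range]
  nlinarith

/-- A term of the complete Bell polynomial, up to a factor `k!`. -/
def bellTerm {K : ℕ} (x : ℕ → ℝ) (j : Fin K → ℕ) : ℝ :=
  ∏ m, (x (m.val + 1) / ((m.val + 1)! : ℝ)) ^ j m / ((j m)! : ℝ)

theorem bellTerm_add_single {K : ℕ} (x : ℕ → ℝ) (j : Fin K → ℕ) (a : Fin K) :
    ((j a + 1 : ℕ) : ℝ) * bellTerm x (j + Pi.single a 1) =
      x (a.val + 1) / ((a.val + 1)! : ℝ) * bellTerm x j := by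
  rw [bellTerm, bellTerm, ← Finset.mul_prod_erase _ _ (Finset.mem_univ a),
    ← Finset.mul_prod_erase _ _ (Finset.mem_univ a)]
  have h : ∀ m ∈ Finset.univ.erase a, (x (m.val + 1) / ((m.val + 1)! : ℝ)) ^
      (j + Pi.single a 1 : Fin K → ℕ) m / (((j + Pi.single a 1 : Fin K → ℕ) m)! : ℝ) =
      (x (m.val + 1) / ((m.val + 1)! : ℝ)) ^ j m / ((j m)! : ℝ) := by
    intro m hm
    simp [Finset.ne_of_mem_erase hm]
  rw [Finset.prod_congr rfl h]
  simp only [Pi.add_apply, Pi.single_eq_same, Nat.factorial_succ (j a), pow_succ]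
  push_cast
  have h1 : ((j a)! : ℝ) ≠ 0 := by positivity
  have h2 : ((j a : ℝ) + 1) ≠ 0 := by positivity
  field_simp

/-- Coefficient form of `t F' = t X' F` for `F = exp X`, `X = ∑ x_m t^m / m!`. Write `k` as `∑ (a +
1) j a` and remove one part of size `a + 1`; the `j` with `j a = 0` contribute nothing. -/
theorem mul_sum_bellTerm (K k : ℕ) (x : ℕ → ℝ) :
    (k : ℝ) * ∑ j ∈ multiplicities K k, bellTerm x j =
      ∑ a : Fin K, if a.val + 1 ≤ k then x (a.val + 1) / (a.val ! : ℝ) *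
        ∑ j ∈ multiplicities K (k - (a.val + 1)), bellTerm x j else 0 := by
  have h : ∀ j ∈ multiplicities K k, (k : ℝ) * bellTerm x j =
      ∑ a : Fin K, ((a.val + 1 : ℕ) : ℝ) * ((j a : ℝ) * bellTerm x j) := by
    intro j hj
    rw [mem_multiplicities] at hj
    nth_rw 1 [← hj]
    push_cast
    rw [Finset.sum_mul]
    simp only [mul_assoc]
  rw [Finset.mul_sum, Finset.sum_congr rfl h, Finset.sum_comm]
  refine Finset.sum_congr rfl fun a _ => ?_
  have hsum : ∀ j : Fin K → ℕ, ∑ m, (m.val + 1) * (j + Pi.single a 1 : Fin K → ℕ) m =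
      ∑ m, (m.val + 1) * j m + (a.val + 1) := by
    intro j
    simp [mul_add, Finset.sum_add_distrib, Pi.single_apply]
  split_ifs with hak
  · rw [← Finset.mul_sum]
    have : ∑ j ∈ multiplicities K k, (j a : ℝ) * bellTerm x j =
        ∑ j ∈ multiplicities K (k - (a.val + 1)),
          x (a.val + 1) / ((a.val + 1)! : ℝ) * bellTerm x j := by
      symm
      refine Finset.sum_of_injOn (fun j => j + Pi.single a 1) (fun _ _ _ _ h => add_right_cancel h)
        ?_ ?_ ?_
      · intro j hj
        rw [Finset.mem_coe, mem_multiplicities] at hj ⊢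
        rw [hsum, hj]
        omega
      · intro j hj hj'
        have : j a = 0 := by
          by_contra h0
          refine hj' ⟨j - Pi.single a 1, ?_, ?_⟩
          · rw [Finset.mem_coe, mem_multiplicities]
            have h1 := hsum (j - Pi.single a 1)
            rw [tsub_add_cancel_of_le, mem_multiplicities.1 hj] at h1
            · omega
            · intro b
              rcases eq_or_ne b a with rfl | hb
              · simpa using Nat.one_le_iff_ne_zero.2 h0
              · simp [hb]
          · refine tsub_add_cancel_of_le fun b => ?_
            rcases eq_or_ne b a with rfl | hb
            · simpa using Nat.one_le_iff_ne_zero.2 h0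
            · simp [hb]
        simp [this]
      · intro j _
        rw [← bellTerm_add_single]
        simp
    rw [this, ← Finset.mul_sum, ← mul_assoc]
    congr 1
    rw [Nat.factorial_succ]
    push_cast
    have h2 : ((a.val : ℝ) + 1) ≠ 0 := by positivity
    field_simp
  · refine Finset.sum_eq_zero fun j hj => ?_
    have : j a = 0 := by
      by_contra h0
      have h1 := Finset.single_le_sum (f := fun m : Fin K => (m.val + 1) * j m)
        (fun _ _ => Nat.zero_le _) (Finset.mem_univ a)
      rw [mem_multiplicities.1 hj] at h1
      have h2 := Nat.pos_of_ne_zero h0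
      nlinarith
    simp [this]

/-- With `i` parts no part exceeds `k - i + 1`, so padding by zeros moves every inner sum to one
index type. The freedom in `K` lets the recursion compare different `k`. -/
theorem bell_eq_sum_bellTerm {K k : ℕ} (hk : k ≤ K) (x : ℕ → ℝ) :
    bell k x = (k ! : ℝ) * ∑ j ∈ multiplicities K k, bellTerm x j := by
  rcases Nat.eq_zero_or_pos k with rfl | hpos
  · have : multiplicities K 0 = {0} := by
      ext j
      simp [mem_multiplicities, funext_iff]
    simp [bell, this, bellTerm]
  have hmaps : ∀ j ∈ multiplicities K k, ∑ m, j m ∈ Finset.Icc 1 k := by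
    intro j hj
    rw [mem_multiplicities] at hj
    rw [Finset.mem_Icc]
    constructor
    · rw [Nat.one_le_iff_ne_zero]
      intro h0
      rw [Finset.sum_eq_zero_iff] at h0
      rw [Finset.sum_eq_zero (fun m hm => by rw [h0 m hm, mul_zero])] at hj
      omega
    · rw [← hj]
      exact Finset.sum_le_sum fun m _ => Nat.le_mul_of_pos_left _ (Nat.succ_pos _)
  rw [bell, if_neg hpos.ne', ← Finset.sum_fiberwise_of_maps_to hmaps, Finset.mul_sum]
  refine Finset.sum_congr rfl fun i hi => ?_
  rw [Finset.mem_Icc] at hi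
  have hL : k - i + 1 ≤ K := by omega
  rw [Finset.mul_sum]
  -- Stated for any commutative monoid: `Multiplicative ℕ` then gives the version for sums.
  have hcast : ∀ {M : Type} [CommMonoid M] (f : Fin K → M),
      (∀ m : Fin K, k - i + 1 ≤ m.val → f m = 1) →
      ∏ m : Fin (k - i + 1), f (Fin.castLE hL m) = ∏ m, f m := by
    intro M _ f hf
    refine Finset.prod_of_injOn (Fin.castLE hL) (Fin.castLE_injective hL).injOn
      (fun _ _ => Finset.mem_coe.2 (Finset.mem_univ _)) ?_ (fun _ _ => rfl)
    intro m _ hm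
    refine hf m (not_lt.1 fun hlt => hm ⟨⟨m.val, hlt⟩, by simp, by simp⟩)
  have hcast' : ∀ (f : Fin K → ℕ),
      (∀ m : Fin K, k - i + 1 ≤ m.val → f m = 0) →
      ∑ m : Fin (k - i + 1), f (Fin.castLE hL m) = ∑ m, f m :=
    fun f hf => hcast (M := Multiplicative ℕ) f hf
  let e : (Fin (k - i + 1) → ℕ) → Fin K → ℕ :=
    fun j m => if h : m.val < k - i + 1 then j ⟨m.val, h⟩ else 0
  have he : ∀ j m, e j (Fin.castLE hL m) = j m := fun j m => dif_pos m.isLt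
  have he0 : ∀ j (m : Fin K), k - i + 1 ≤ m.val → e j m = 0 := fun j m h =>
    dif_neg (not_lt.2 h)
  refine Finset.sum_of_injOn e ?_ ?_ ?_ ?_
  · intro j _ j' _ h
    funext m
    rw [← he j, ← he j', h]
  · intro j hj
    simp only [Finset.coe_filter, Finset.mem_piAntidiag, Set.mem_ofPred_eq,
      mem_multiplicities] at hj ⊢
    rw [← hcast' _ (he0 j), ← hcast' _ (fun m h => by rw [he0 j m h, mul_zero])]
    simp only [he]
    exact ⟨hj.2, hj.1.1⟩
  · intro j hj hj'
    exfalso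
    rw [Finset.mem_filter, mem_multiplicities] at hj
    have hj0 : ∀ m : Fin K, k - i + 1 ≤ m.val → j m = 0 := by
      intro m hm
      have h1 : ∑ m : Fin K, m.val * j m + i = k := by
        rw [← hj.1, ← hj.2, ← Finset.sum_add_distrib]
        simp only [add_mul, one_mul]
      have h2 := Finset.single_le_sum (f := fun m : Fin K => m.val * j m)
        (fun _ _ => Nat.zero_le _) (Finset.mem_univ m)
      by_contra h0
      have h3 : m.val * 1 ≤ m.val * j m := Nat.mul_le_mul_left _ (Nat.pos_of_ne_zero h0)
      omega
    refine hj' ⟨fun m => j (Fin.castLE hL m), ?_, ?_⟩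
    · simp only [Finset.coe_filter, Finset.mem_piAntidiag, Set.mem_ofPred_eq]
      have h1 := hcast' _ hj0
      have h2 := hcast' (fun m => (m.val + 1) * j m) (fun m h => by rw [hj0 m h, mul_zero])
      refine ⟨⟨h1.trans hj.2, by simp⟩, h2.trans hj.1⟩
    · funext m
      by_cases h : m.val < k - i + 1
      · exact dif_pos h
      · exact (dif_neg h).trans (hj0 m (not_lt.1 h)).symm
  · intro j _
    rw [bellTerm, ← hcast _ (fun m h => by rw [he0 j m h]; simp)]
    simp only [he, Fin.val_castLE, Finset.prod_div_distrib]
    ring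

theorem bell_zero (x : ℕ → ℝ) : bell 0 x = 1 := by simp [bell]

theorem bell_succ (k : ℕ) (x : ℕ → ℝ) :
    bell (k + 1) x =
      ∑ i ∈ Finset.range (k + 1), (k.choose i : ℝ) * x (i + 1) * bell (k - i) x := by
  have h := mul_sum_bellTerm (k + 1) (k + 1) x
  rw [bell_eq_sum_bellTerm le_rfl, Nat.factorial_succ, Nat.cast_mul, mul_comm ((k + 1 : ℕ) : ℝ),
    mul_assoc, h, Finset.mul_sum, Finset.sum_range]
  refine Finset.sum_congr rfl fun i _ => ?_
  have hi : i.val ≤ k := by omega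
  rw [if_pos (by omega), bell_eq_sum_bellTerm (K := k + 1) (by omega : k - i.val ≤ k + 1),
    ← Nat.choose_mul_factorial_mul_factorial hi, show k + 1 - (i.val + 1) = k - i.val by omega]
  have : (i.val ! : ℝ) ≠ 0 := by positivity
  push_cast
  field_simp

/-- The first column has only two nonzero entries. One minor is the smaller Bell matrix, the other
is that matrix with first row the shifted `y`; an arbitrary first row makes the induction close. -/
theorem det_bellMatrix_updateRow (k : ℕ) (x y : ℕ → ℝ) :
    ((bellMatrix (k + 1) x).updateRow 0 fun c => y c.val).det =
      ∑ i ∈ Finset.range (k + 1), y i * (bellMatrix (k - i) x).det := by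
  induction k generalizing y with
  | zero => simp [Matrix.updateRow_apply]
  | succ k ih =>
    rw [Matrix.det_succ_column_zero, Fin.sum_univ_succ, Fin.sum_univ_succ, Finset.sum_eq_zero,
      add_zero, Finset.sum_range_succ', add_comm]
    · congr 1
      · rw [Matrix.updateRow_ne (by simp)]
        have h1 : bellMatrix (k + 1 + 1) x (Fin.succ 0) 0 = -1 := by simp [bellMatrix]
        have h2 : ((bellMatrix (k + 1 + 1) x).updateRow 0 fun c => y c.val).submatrix
            (Fin.succ 0).succAbove Fin.succ =
            (bellMatrix (k + 1) x).updateRow 0 fun c => y (c.val + 1) := by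
          ext r c
          refine Fin.cases ?_ (fun r => ?_) r
          · simp
          · have : (Fin.succ (0 : Fin (k + 1))).succAbove r.succ = r.succ.succ := by
              simp
            rw [Matrix.submatrix_apply, this, Matrix.updateRow_ne (by simp),
              Matrix.updateRow_ne (by simp)]
            simp [bellMatrix]
        rw [h1, h2, ih (fun i => y (i + 1))]
        simp only [Fin.val_succ, Fin.val_zero, zero_add, pow_one, mul_neg, mul_one, neg_neg, one_mul]
        refine Finset.sum_congr rfl fun i _ => ?_
        rw [Nat.add_sub_add_right]
      · have h2 : ((bellMatrix (k + 1 + 1) x).updateRow 0 fun c => y c.val).submatrix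
            (Fin.succAbove 0) Fin.succ = bellMatrix (k + 1) x := by
          ext r c
          rw [Matrix.submatrix_apply, Fin.succAbove_zero, Matrix.updateRow_ne (by simp)]
          simp [bellMatrix]
        rw [h2]
        simp
    · intro i _
      rw [Matrix.updateRow_ne (by simp)]
      simp [bellMatrix]

theorem bell_eq_det_bellMatrix (k : ℕ) (x : ℕ → ℝ) : bell k x = (bellMatrix k x).det := by
  induction k using Nat.strong_induction_on with
  | _ k ih =>
    cases k with
    | zero => simp [bell]
    | succ k =>
      have h := det_bellMatrix_updateRow k x fun c => (k.choose c : ℝ) * x (c + 1)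
      have h2 : ((bellMatrix (k + 1) x).updateRow 0 fun c =>
          (k.choose c.val : ℝ) * x (c.val + 1)) = bellMatrix (k + 1) x := by
        ext r c
        rw [Matrix.updateRow_apply]
        split_ifs with hr
        · simp [hr, bellMatrix]
        · rfl
      rw [h2] at h
      rw [h, bell_succ]
      refine Finset.sum_congr rfl fun i _ => ?_
      rw [ih (k - i) (by omega)]

/-! ### The standard basis and the trace of `β(U)` -/

variable {p q : ℕ}

/-- The standard basis `e_{a₁} ⋯ e_{a_k}`, `a₁ < ⋯ < a_k`, of `Cl_{p,q}`. -/
def stdBasis (p q : ℕ) : Module.Basis (Finset (Fin (p + q))) ℝ (Cl p q) :=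
  (Pi.basisFun ℝ (Fin (p + q))).ExteriorAlgebra.map (CliffordAlgebra.equivExterior (form p q)).symm

theorem stdBasis_apply (A : Finset (Fin (p + q))) : stdBasis p q A = basisElt p q A := by
  rw [stdBasis, Module.Basis.map_apply, LinearEquiv.symm_apply_eq, basisElt,
    equivExterior_prod _ (A.sort_nodup _), ExteriorAlgebra.basis_apply_ofCard _ rfl,
    ExteriorAlgebra.ιMulti_family, ExteriorAlgebra.ιMulti_apply]
  congr 1
  refine List.ext_getElem (by simp) fun i h1 h2 => ?_
  simp [Set.powersetCard.ofFinEmbEquiv_symm_apply, Finset.orderEmbOfFin_apply]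

/-- Each factor passed costs a sign unless it is `e_a` itself; only the parity of the exponent
matters, so the count may be added. -/
theorem gen_mul_prod (a : Fin (p + q)) (l : List (Fin (p + q))) :
    gen p q a * (l.map (gen p q)).prod =
      (-1 : ℝ) ^ (l.length + l.count a) • ((l.map (gen p q)).prod * gen p q a) := by
  induction l with
  | nil => simp
  | cons b l ih =>
    rw [List.map_cons, List.prod_cons]
    rcases eq_or_ne b a with rfl | h
    · nth_rw 1 [ih]
      rw [mul_assoc (gen p q b), List.count_cons_self, List.length_cons,
        show l.length + 1 + (l.count b + 1) = l.length + l.count b + 2 by ring,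
        pow_add _ _ 2, neg_one_sq, mul_one, mul_smul_comm]
    · rw [← mul_assoc, eq_neg_of_add_eq_zero_left (gen_anticomm h.symm), neg_mul, mul_assoc, ih,
        List.count_cons_of_ne h, List.length_cons, mul_smul_comm, ← neg_smul, mul_assoc]
      congr 1
      ring

theorem gen_mul_basisElt (a : Fin (p + q)) (A : Finset (Fin (p + q))) :
    gen p q a * basisElt p q A =
      (-1 : ℝ) ^ (A.card + if a ∈ A then 1 else 0) • (basisElt p q A * gen p q a) := by
  rw [basisElt, gen_mul_prod, Finset.length_sort, (A.sort_nodup _).count]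
  simp

theorem exists_prod_mul_self (l : List (Fin (p + q))) :
    ∃ s : ℝ, s ≠ 0 ∧
      (l.map (gen p q)).prod * (l.map (gen p q)).prod = algebraMap ℝ (Cl p q) s := by
  induction l with
  | nil => exact ⟨1, one_ne_zero, by simp⟩
  | cons a l ih =>
    obtain ⟨s, hs, h⟩ := ih
    refine ⟨(-1) ^ (l.length + l.count a) * (s * if a.val < p then 1 else -1), ?_, ?_⟩
    · refine mul_ne_zero (pow_ne_zero _ (by norm_num)) (mul_ne_zero hs ?_)
      split_ifs <;> norm_num
    · rw [List.map_cons, List.prod_cons]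
      nth_rw 1 [gen_mul_prod]
      rw [smul_mul_assoc, mul_assoc, ← mul_assoc (gen p q a) (gen p q a), gen_mul_self,
        Algebra.commutes, ← mul_assoc, h, ← map_mul, Algebra.smul_def, ← map_mul]

/-- `β.mat` as a ring homomorphism. -/
def Rep.matHom (β : Rep p q) : Cl p q →+*
    Matrix (Fin (2 ^ ((p + q) / 2)) × Fin ((p + q) % 2 + 1))
      (Fin (2 ^ ((p + q) / 2)) × Fin ((p + q) % 2 + 1)) ℂ :=
  (Matrix.blockDiagonalRingHom _ _ ℂ).comp
    ((β : (ℂ ⊗[ℝ] Cl p q) →+* MatAlg (p + q)).comp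
      (Algebra.TensorProduct.includeRight : Cl p q →ₐ[ℝ] ℂ ⊗[ℝ] Cl p q).toRingHom)

theorem Rep.matHom_apply (β : Rep p q) (U : Cl p q) : β.matHom U = β.mat U := rfl

theorem Rep.apply_tmul (β : Rep p q) (c : ℂ) (U : Cl p q) :
    β (c ⊗ₜ[ℝ] U) = c • β ((1 : ℂ) ⊗ₜ[ℝ] U) := by
  rw [← map_smul, TensorProduct.smul_tmul', smul_eq_mul, mul_one]

theorem Rep.mat_smul (β : Rep p q) (r : ℝ) (U : Cl p q) : β.mat (r • U) = (r : ℂ) • β.mat U := by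
  rw [Rep.mat, Rep.mat, TensorProduct.tmul_smul, TensorProduct.smul_tmul', β.apply_tmul,
    Matrix.blockDiagonal_smul]
  simp

theorem Rep.mat_algebraMap (β : Rep p q) (r : ℝ) :
    β.mat (algebraMap ℝ (Cl p q) r) = (r : ℂ) • 1 := by
  rw [Algebra.algebraMap_eq_smul_one, β.mat_smul, ← β.matHom_apply, map_one]

theorem card_dimN (p q : ℕ) :
    Fintype.card (Fin (2 ^ ((p + q) / 2)) × Fin ((p + q) % 2 + 1)) = dimN p q := by
  rw [Fintype.card_prod, Fintype.card_fin, Fintype.card_fin, dimN]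
  rcases Nat.mod_two_eq_zero_or_one (p + q) with h | h
  · rw [h, show (p + q + 1) / 2 = (p + q) / 2 by omega, zero_add, mul_one]
  · rw [h, show (p + q + 1) / 2 = (p + q) / 2 + 1 by omega, pow_succ]

/-- `e_a U e_a = -U e_a²`, while cyclicity gives both sides of `e_a U e_a`, `U e_a²` the same trace;
and `e_a² = ±1`. -/
theorem Rep.trace_mat_eq_zero_of_anticomm (β : Rep p q) {a : Fin (p + q)} {U : Cl p q}
    (h : gen p q a * U = -(U * gen p q a)) : (β.mat U).trace = 0 := by
  have h1 : gen p q a * U * gen p q a = -(U * (gen p q a * gen p q a)) := by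
    rw [h, neg_mul, mul_assoc]
  have h2 : (β.mat (gen p q a * U * gen p q a)).trace =
      (β.mat (U * (gen p q a * gen p q a))).trace := by
    simp only [← β.matHom_apply, map_mul]
    rw [Matrix.trace_mul_comm, Matrix.trace_mul_comm (β.matHom U), mul_assoc]
  rw [h1, ← β.matHom_apply, map_neg, Matrix.trace_neg, β.matHom_apply, neg_eq_self,
    gen_mul_self, ← Algebra.commutes, ← Algebra.smul_def, β.mat_smul, Matrix.trace_smul,
    smul_eq_zero] at h2
  refine h2.resolve_left ?_
  split_ifs <;> norm_num

theorem commute_of_forall_gen {z : Cl p q} (h : ∀ a, Commute z (gen p q a)) (U : Cl p q) :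
    Commute z U := by
  have hU := (stdBasis p q).mem_span U
  induction hU using Submodule.span_induction with
  | mem x hx =>
    obtain ⟨A, rfl⟩ := hx
    rw [stdBasis_apply, basisElt]
    exact Commute.list_prod_right _ _ fun x hx => by
      obtain ⟨a, -, rfl⟩ := List.mem_map.1 hx
      exact h a
  | zero => exact Commute.zero_right z
  | add x y _ _ hx hy => exact hx.add_right hy
  | smul r x _ hx => exact hx.smul_right r

/-- Centrality makes each of the two blocks a scalar, and both scalars square to `s`. They cannot be
equal, so they are opposite. -/
theorem Rep.trace_mat_eq_zero_of_central (β : Rep p q) (hn : (p + q) % 2 = 1) {z : Cl p q}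
    (hz : ∀ U, Commute z U) {s : ℝ} (hs : s ≠ 0) (hzz : z * z = algebraMap ℝ (Cl p q) s)
    (hz0 : scalarPart p q z = 0) : (β.mat z).trace = 0 := by
  set Z : MatAlg (p + q) := β ((1 : ℂ) ⊗ₜ[ℝ] z) with hZ
  have hcomm : ∀ W, Commute Z W := by
    intro W
    obtain ⟨w, rfl⟩ := β.surjective W
    refine Commute.map (f := β) ?_
    induction w with
    | zero => exact Commute.zero_right _
    | add x y hx hy => exact hx.add_right hy
    | tmul c U =>
      rw [commute_iff_eq, Algebra.TensorProduct.tmul_mul_tmul, Algebra.TensorProduct.tmul_mul_tmul,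
        (hz U).eq, one_mul, mul_one]
  have hscalar : ∀ i, ∃ c : ℂ, Z i = c • 1 := by
    intro i
    have : Z i ∈ Set.range (Matrix.scalar (Fin (2 ^ ((p + q) / 2)))) := by
      refine Matrix.mem_range_scalar_iff_commute_single'.2 fun j k => ?_
      have := congrFun (hcomm (Pi.single i (Matrix.single j k 1))).eq i
      rw [commute_iff_eq]
      simpa using this.symm
    obtain ⟨c, hc⟩ := this
    exact ⟨c, by rw [← hc, Matrix.scalar_apply, Matrix.smul_one_eq_diagonal]⟩
  choose c hc using hscalar
  have hsq : ∀ i, c i * c i = (s : ℂ) := by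
    intro i
    have h1 : Z * Z = (s : ℂ) • 1 := by
      rw [hZ, ← map_mul, Algebra.TensorProduct.tmul_mul_tmul, hzz, Algebra.algebraMap_eq_smul_one,
        mul_one, TensorProduct.tmul_smul, TensorProduct.smul_tmul', β.apply_tmul,
        ← Algebra.TensorProduct.one_def, map_one]
      simp
    have h2 := congrFun h1 i
    rw [Pi.mul_apply, hc i, Pi.smul_apply, Pi.one_apply, smul_mul_smul_comm, mul_one] at h2
    have h3 := congrFun (congrFun h2 ⟨0, by positivity⟩) ⟨0, by positivity⟩
    simpa using h3
  have hne : ∀ i j, i ≠ j → c i = - c j := by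
    intro i j hij
    rcases mul_self_eq_mul_self_iff.1 ((hsq i).trans (hsq j).symm) with h | h
    -- Equal scalars would give `1 ⊗ z = c i ⊗ 1` by injectivity of `β`; taking scalar parts, `c i =
    -- 0`, against `s ≠ 0`.
    · exfalso
      have hall : ∀ k, c k = c i := by
        intro k
        have h1 := i.isLt
        have h2 := j.isLt
        have h3 := k.isLt
        have : k = i ∨ k = j := by
          simp only [Fin.ext_iff] at hij ⊢
          omega
        rcases this with rfl | rfl
        · rfl
        · exact h.symm
      have h1 : β ((1 : ℂ) ⊗ₜ[ℝ] z) = β (c i ⊗ₜ[ℝ] 1) := by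
        rw [β.apply_tmul (c i), ← Algebra.TensorProduct.one_def, map_one, ← hZ]
        funext k
        rw [hc, hall]
        rfl
      have h2 := congrArg ((scalarPart p q).baseChange ℂ) (β.injective h1)
      rw [LinearMap.baseChange_tmul, LinearMap.baseChange_tmul, hz0] at h2
      have h3 : scalarPart p q 1 = 1 := by
        have := scalarPart_basisElt (p := p) (q := q) ∅
        simpa [basisElt] using this
      rw [h3, TensorProduct.tmul_zero] at h2
      have h4 := congrArg (TensorProduct.rid ℝ ℂ) h2
      simp only [map_zero, TensorProduct.rid_tmul, one_smul] at h4
      have h5 := hsq i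
      rw [← h4, mul_zero] at h5
      exact hs (by exact_mod_cast h5.symm)
    · exact h
  rw [Rep.mat, Matrix.trace_blockDiagonal, ← hZ]
  have hsum : ∑ i, c i = 0 := by
    have e : Fin 2 ≃ Fin ((p + q) % 2 + 1) := finCongr (by omega)
    rw [← e.sum_comp, Fin.sum_univ_two, hne (e 0) (e 1) (by simp), neg_add_cancel]
  simp only [hc, Matrix.trace_smul, ← Finset.sum_smul, hsum, zero_smul]

theorem Rep.trace_mat (β : Rep p q) (U : Cl p q) :
    (β.mat U).trace = (dimN p q : ℂ) * (scalarPart p q U : ℂ) := by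
  have hU := (stdBasis p q).mem_span U
  induction hU using Submodule.span_induction with
  | mem x hx =>
    obtain ⟨A, rfl⟩ := hx
    rw [stdBasis_apply, scalarPart_basisElt]
    split_ifs with hA
    · subst hA
      have : basisElt p q ∅ = 1 := by simp [basisElt]
      rw [this, ← β.matHom_apply, map_one, Matrix.trace_one, card_dimN]
      simp
    · rw [Complex.ofReal_zero, mul_zero]
      by_cases h : ∃ a, Odd (A.card + if a ∈ A then 1 else 0)
      · obtain ⟨a, ha⟩ := h
        refine β.trace_mat_eq_zero_of_anticomm (a := a) ?_
        rw [gen_mul_basisElt, ha.neg_one_pow, neg_one_smul]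
      -- Here every generator commutes with the product. Members of `A` force `A.card` odd,
      -- non-members force it even, so `A` is everything, `n` is odd and the product is central.
      · simp only [not_exists, Nat.not_odd_iff_even] at h
        obtain ⟨a, ha⟩ := Finset.nonempty_iff_ne_empty.2 hA
        have h1 := h a
        rw [if_pos ha] at h1
        have huniv : A = Finset.univ := by
          refine Finset.eq_univ_iff_forall.2 fun b => ?_
          by_contra hb
          have h2 := h b
          rw [if_neg hb] at h2
          grind
        obtain ⟨s, hs, hss⟩ := exists_prod_mul_self (A.sort (· ≤ ·))
        refine β.trace_mat_eq_zero_of_central ?_ (commute_of_forall_gen fun b => ?_) hs hss ?_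
        · rw [huniv, Finset.card_univ, Fintype.card_fin] at h1
          grind
        · have := gen_mul_basisElt b A
          rw [(h b).neg_one_pow, one_smul] at this
          exact this.symm
        · rw [scalarPart_basisElt, if_neg hA]
  | zero => simp [← β.matHom_apply]
  | add x y _ _ hx hy =>
    rw [← β.matHom_apply, map_add, Matrix.trace_add, β.matHom_apply, β.matHom_apply, hx, hy, map_add]
    push_cast
    ring
  | smul r x _ hx =>
    rw [β.mat_smul, Matrix.trace_smul, hx, map_smul, smul_eq_mul, smul_eq_mul]
    push_cast
    ring

/-! ### Existence of representations -/

/-- The algebra `A` is generated by `n` pairwise anticommuting elements of square `1`. -/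
def HasCliffordGens (n : ℕ) (A : Type*) [Ring A] [Algebra ℂ A] : Prop :=
  ∃ γ : Fin n → A, (∀ a, γ a * γ a = 1) ∧ (∀ a b, a ≠ b → γ a * γ b + γ b * γ a = 0) ∧
    Algebra.adjoin ℂ (Set.range γ) = ⊤

theorem HasCliffordGens.of_algEquiv {n : ℕ} {A B : Type*} [Ring A] [Algebra ℂ A] [Ring B]
    [Algebra ℂ B] (h : HasCliffordGens n A) (e : A ≃ₐ[ℂ] B) : HasCliffordGens n B := by
  obtain ⟨γ, h1, h2, h3⟩ := h
  refine ⟨e ∘ γ, fun a => ?_, fun a b hab => ?_, ?_⟩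
  · simp [← map_mul, h1]
  · simp [← map_mul, ← map_add, h2 a b hab]
  · rw [Set.range_comp, ← AlgEquiv.coe_toAlgHom, ← AlgHom.map_adjoin, h3, Algebra.map_top,
      AlgHom.range_eq_top]
    exact e.surjective

/-- The generators are `γ_a ⊗ σ₃`, `1 ⊗ σ₁`, `1 ⊗ σ₂` with Pauli matrices. Since `σ₃ = -i σ₁ σ₂`,
they generate the matrix units and every `γ_a ⊗ 1`, hence everything. -/
theorem HasCliffordGens.matrix {n : ℕ} {A : Type*} [Ring A] [Algebra ℂ A]
    (h : HasCliffordGens n A) : HasCliffordGens (n + 2) (Matrix (Fin 2) (Fin 2) A) := by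
  obtain ⟨γ, h1, h2, h3⟩ := h
  let J : A := algebraMap ℂ A Complex.I
  have hJJ : J * J = -1 := by rw [← map_mul, Complex.I_mul_I, map_neg, map_one]
  have hJ : ∀ a, J * γ a = γ a * J := fun a => Algebra.commutes _ _
  have hIJ : Complex.I • J = -1 := by rw [Algebra.smul_def, hJJ]
  have h0 : (!![0, 0; 0, 0] : Matrix (Fin 2) (Fin 2) A) = 0 := by
    ext i j
    fin_cases i <;> fin_cases j <;> rfl
  let g : Fin n ⊕ Fin 2 → Matrix (Fin 2) (Fin 2) A :=
    Sum.elim (fun a => !![γ a, 0; 0, -γ a]) ![!![0, 1; 1, 0], !![0, -J; J, 0]]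
  refine ⟨g ∘ finSumFinEquiv.symm, fun a => ?_, fun a b hab => ?_, ?_⟩
  · obtain ⟨a, rfl⟩ := finSumFinEquiv.surjective a
    rw [Function.comp_apply, Equiv.symm_apply_apply]
    rcases a with a | a
    · simp [g, h1, Matrix.one_fin_two]
    · fin_cases a <;> simp [g, hJJ, Matrix.one_fin_two]
  · obtain ⟨a, rfl⟩ := finSumFinEquiv.surjective a
    obtain ⟨b, rfl⟩ := finSumFinEquiv.surjective b
    simp only [Function.comp_apply, Equiv.symm_apply_apply]
    replace hab : a ≠ b := fun h => hab (by rw [h])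
    rcases a with a | a <;> rcases b with b | b
    · have := h2 a b (fun h => hab (by rw [h]))
      simp [g, this, h0]
    · fin_cases b <;> simp [g, hJ, h0]
    · fin_cases a <;> simp [g, hJ, h0]
    · fin_cases a <;> fin_cases b <;> simp_all [g]
  · rw [Set.range_comp, Equiv.range_eq_univ, Set.image_univ]
    set S := Algebra.adjoin ℂ (Set.range g) with hS
    have hg : ∀ a, g a ∈ S := fun a => Algebra.subset_adjoin ⟨a, rfl⟩
    have hs1 : (!![0, 1; 1, 0] : Matrix (Fin 2) (Fin 2) A) ∈ S := hg (.inr 0)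
    have hs2 : (!![0, -J; J, 0] : Matrix (Fin 2) (Fin 2) A) ∈ S := hg (.inr 1)
    have hs3 : (!![1, 0; 0, -1] : Matrix (Fin 2) (Fin 2) A) ∈ S := by
      have := S.smul_mem (S.mul_mem hs1 hs2) (-Complex.I)
      convert this using 1
      ext i j
      fin_cases i <;> fin_cases j <;> simp [hIJ]
    have hE : ∀ i j, (Matrix.single i j 1 : Matrix (Fin 2) (Fin 2) A) ∈ S := by
      have h00 : (Matrix.single 0 0 1 : Matrix (Fin 2) (Fin 2) A) ∈ S := by
        have := S.smul_mem (S.add_mem S.one_mem hs3) (1 / 2 : ℂ)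
        convert this using 1
        rw [Matrix.one_fin_two]
        ext i j
        fin_cases i <;> fin_cases j <;> simp [← two_smul ℂ, smul_smul]
      have h11 : (Matrix.single 1 1 1 : Matrix (Fin 2) (Fin 2) A) ∈ S := by
        have := S.sub_mem S.one_mem h00
        convert this using 1
        rw [Matrix.one_fin_two]
        ext i j
        fin_cases i <;> fin_cases j <;> simp
      intro i j
      fin_cases i <;> fin_cases j
      · exact h00
      · convert S.mul_mem h00 hs1 using 1
        ext i j
        fin_cases i <;> fin_cases j <;> simp [Matrix.mul_apply]
      · convert S.mul_mem h11 hs1 using 1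
        ext i j
        fin_cases i <;> fin_cases j <;> simp [Matrix.mul_apply]
      · exact h11
    have hscal : ∀ x : A, Matrix.scalar (Fin 2) x ∈ S := by
      intro x
      have hx : x ∈ Algebra.adjoin ℂ (Set.range γ) := h3 ▸ Algebra.mem_top
      have hle : (Algebra.adjoin ℂ (Set.range γ)).map (Matrix.scalarAlgHom (Fin 2) ℂ) ≤ S := by
        rw [AlgHom.map_adjoin, Algebra.adjoin_le_iff]
        rintro _ ⟨_, ⟨a, rfl⟩, rfl⟩
        have : Matrix.scalarAlgHom (Fin 2) ℂ (γ a) = g (.inl a) * !![1, 0; 0, -1] := by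
          ext i j
          fin_cases i <;> fin_cases j <;> simp [g]
        rw [SetLike.mem_coe]
        exact this ▸ S.mul_mem (hg (.inl a)) hs3
      exact hle ⟨x, hx, rfl⟩
    refine eq_top_iff.2 fun M _ => ?_
    rw [Matrix.matrix_eq_sum_single M]
    refine S.sum_mem fun i _ => S.sum_mem fun j _ => ?_
    convert S.mul_mem (hscal (M i j)) (hE i j) using 1
    ext k l
    rw [Matrix.scalar_apply, Matrix.diagonal_mul]
    simp [Matrix.single_apply]

/-- `Mat(2, MatAlg n)` is `MatAlg (n + 2)`. -/
def matrixMatAlgEquiv (n : ℕ) : Matrix (Fin 2) (Fin 2) (MatAlg n) ≃ₐ[ℂ] MatAlg (n + 2) :=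
  (Matrix.piAlgEquiv ℂ).trans <|
    (AlgEquiv.piCongrRight fun _ => (Matrix.compAlgEquiv (Fin 2) (Fin (2 ^ (n / 2))) ℂ ℂ).trans <|
      Matrix.reindexAlgEquiv ℂ ℂ <| finProdFinEquiv.trans <| finCongr <| by
        rw [Nat.add_div_right n two_pos, pow_succ']).trans <|
    AlgEquiv.piCongrLeft ℂ (fun _ => Matrix _ _ ℂ) (finCongr (by omega))

theorem hasCliffordGens_matAlg (n : ℕ) : HasCliffordGens n (MatAlg n) := by
  induction n using Nat.twoStepInduction with
  | zero =>
    refine ⟨Fin.elim0, fun a => a.elim0, fun a => a.elim0, eq_top_iff.2 fun M _ => ?_⟩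
    have : M = algebraMap ℂ (MatAlg 0) (M 0 0 0) := by
      funext i
      ext j k
      fin_cases i; fin_cases j; fin_cases k
      simp [Matrix.algebraMap_matrix_apply]
    rw [this]
    exact Subalgebra.algebraMap_mem _ _
  | one =>
    refine ⟨fun _ => ![1, -1], fun a => ?_, fun a b hab => (hab (Subsingleton.elim a b)).elim,
      eq_top_iff.2 fun M _ => ?_⟩
    · funext i
      fin_cases i <;> simp
    · have : M = ((M 0 0 0 + M 1 0 0) / 2) • (1 : MatAlg 1) +
          ((M 0 0 0 - M 1 0 0) / 2) • (![1, -1] : MatAlg 1) := by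
        funext i
        ext j k
        fin_cases i <;> fin_cases j <;> fin_cases k <;> simp <;> ring
      rw [this]
      exact add_mem (Subalgebra.smul_mem _ (one_mem _) _)
        (Subalgebra.smul_mem _ (Algebra.subset_adjoin (Set.mem_range_self 0)) _)
  | more n ih _ => exact ih.matrix.of_algEquiv (matrixMatAlgEquiv n)

theorem exists_algHom_surjective {A : Type*} [Ring A] [Algebra ℂ A]
    (h : HasCliffordGens (p + q) A) :
    ∃ f : (ℂ ⊗[ℝ] Cl p q) →ₐ[ℂ] A, Function.Surjective f := by
  obtain ⟨γ, h1, h2, h3⟩ := h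
  -- Over `ℂ` the signature is immaterial: a factor `i` turns square `1` into square `-1`.
  let w : Fin (p + q) → ℂ := fun a => if a.val < p then 1 else Complex.I
  have hw : ∀ a, w a * w a = ((if a.val < p then 1 else -1 : ℝ) : ℂ) := by
    intro a
    simp only [w]
    split_ifs <;> simp
  have hw0 : ∀ a, w a ≠ 0 := by
    intro a
    simp only [w]
    split_ifs <;> simp
  let L : (Fin (p + q) → ℝ) →ₗ[ℝ] A := Fintype.linearCombination ℝ fun a => w a • γ a
  have hL : ∀ v, L v * L v = algebraMap ℝ A (form p q v) := by
    intro v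
    have hsw : ∑ a, ∑ b, (v a • w a • γ a) * (v b • w b • γ b) =
        ∑ a, ∑ b, (v b • w b • γ b) * (v a • w a • γ a) := Finset.sum_comm
    have h4 : L v * L v = ∑ a, ∑ b, (v a • w a • γ a) * (v b • w b • γ b) := by
      simp only [L, Fintype.linearCombination_apply, Finset.sum_mul_sum]
    -- Adding the double sum to its transpose cancels the off-diagonal terms by anticommutation.
    have h5 : (2 : ℝ) • (L v * L v) = (2 : ℝ) • algebraMap ℝ A (form p q v) := by
      rw [two_smul, h4]
      nth_rw 2 [hsw]
      simp only [← Finset.sum_add_distrib]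
      rw [form, QuadraticMap.weightedSumSquares_apply, map_sum, Finset.smul_sum]
      refine Finset.sum_congr rfl fun a _ => ?_
      rw [Finset.sum_eq_single a]
      · rw [← two_smul ℝ, smul_mul_smul_comm, smul_mul_smul_comm, h1, hw,
          Algebra.algebraMap_eq_smul_one, Complex.coe_smul, smul_smul (v a * v a), smul_eq_mul,
          mul_comm (v a * v a)]
      · intro b _ hb
        rw [smul_mul_smul_comm, smul_mul_smul_comm, smul_mul_smul_comm, smul_mul_smul_comm,
          mul_comm (v b), mul_comm (w b), ← smul_add, ← smul_add, h2 a b hb.symm, smul_zero,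
          smul_zero]
      · simp
    exact smul_right_injective A (two_ne_zero' ℝ) h5
  let F : Cl p q →ₐ[ℝ] A := CliffordAlgebra.lift (form p q) ⟨L, hL⟩
  have hF : ∀ a, F (gen p q a) = w a • γ a := by
    intro a
    simp [F, gen, L, Fintype.linearCombination_apply, Pi.single_apply]
  refine ⟨Algebra.TensorProduct.lift (Algebra.ofId ℂ A) F fun c U => Algebra.commutes c (F U), ?_⟩
  rw [← AlgHom.range_eq_top, eq_top_iff, ← h3, Algebra.adjoin_le_iff]
  rintro _ ⟨a, rfl⟩
  refine ⟨(w a)⁻¹ ⊗ₜ[ℝ] gen p q a, ?_⟩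
  refine (Algebra.TensorProduct.lift_tmul ..).trans ?_
  rw [hF, Algebra.ofId_apply, ← Algebra.smul_def, smul_smul, inv_mul_cancel₀ (hw0 a), one_smul]

/-- Both sides have complex dimension `2 ^ n`, so the surjection is bijective. -/
theorem nonempty_rep (p q : ℕ) : Nonempty (Rep p q) := by
  obtain ⟨f, hf⟩ := exists_algHom_surjective (hasCliffordGens_matAlg (p + q))
  have : Module.Finite ℝ (Cl p q) := .of_basis (stdBasis p q)
  have hrank : Module.finrank ℂ (ℂ ⊗[ℝ] Cl p q) = Module.finrank ℂ (MatAlg (p + q)) := by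
    rw [Module.finrank_baseChange, Module.finrank_eq_card_basis (stdBasis p q), Fintype.card_finset,
      Fintype.card_fin, Module.finrank_pi_fintype]
    simp only [Module.finrank_matrix, Fintype.card_fin, Module.finrank_self, Finset.sum_const,
      Finset.card_univ, smul_eq_mul, mul_one, ← pow_add]
    rcases Nat.mod_two_eq_zero_or_one (p + q) with h | h
    · rw [h, zero_add, one_mul]
      congr 1
      omega
    · rw [h, show 1 + 1 = 2 ^ 1 from rfl, ← pow_add]
      congr 1
      omega
  exact ⟨AlgEquiv.ofBijective f
    ⟨(LinearMap.injective_iff_surjective_of_finrank_eq_finrank (f := f.toLinearMap) hrank).2 hf,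
      hf⟩⟩

/-! ### The recursion as a Horner scheme; determinant and adjugate -/

theorem seqU_succ (U : Cl p q) {k : ℕ} (hk : 1 ≤ k) :
    seqU U (k + 1) = U * (seqU U k - algebraMap ℝ (Cl p q) (seqC U k)) := by
  obtain ⟨k, rfl⟩ := Nat.exists_eq_add_of_le' hk
  rfl

theorem mul_seqC (U : Cl p q) {k : ℕ} (hk : 1 ≤ k) :
    (k : ℝ) * seqC U k = dimN p q * scalarPart p q (seqU U k) := by
  have : (k : ℝ) ≠ 0 := by positivity
  rw [seqC]
  field_simp

theorem even_dimN (hn : 1 ≤ p + q) : Even (dimN p q) := by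
  rw [dimN, Nat.even_pow]
  exact ⟨even_two, by omega⟩

theorem two_le_dimN (hn : 1 ≤ p + q) : 2 ≤ dimN p q :=
  Nat.le_self_pow (by omega) 2

/-- Two values of `tr H_{k+1}` are compared: from its recursion and from `trace_charpolyHorner`. The
hypothesis `h` is what the induction in `Rep.mat_seqU` supplies. -/
theorem Rep.seqC_eq_of_mat_seqU (β : Rep p q) (U : Cl p q) {k : ℕ} (hk : k < dimN p q)
    (h : β.mat (seqU U (k + 1)) = β.mat U * (β.mat U).charpolyHorner k) :
    (seqC U (k + 1) : ℂ) = -(β.mat U).charpoly.coeff (dimN p q - (k + 1)) := by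
  have h1 : ((k + 1 : ℕ) : ℂ) * (seqC U (k + 1) : ℂ) =
      (β.mat U * (β.mat U).charpolyHorner k).trace := by
    rw [← h, β.trace_mat]
    exact_mod_cast mul_seqC U (Nat.succ_pos k)
  have h2 := (β.mat U).charpolyHorner_succ k
  have h3 := (β.mat U).trace_charpolyHorner (i := k + 1) (by rw [card_dimN]; omega)
  rw [h2, Matrix.trace_add, ← h1, Matrix.trace_smul, Matrix.trace_one, card_dimN, smul_eq_mul,
    Nat.cast_sub (Nat.succ_le_of_lt hk)] at h3
  have h4 : ((k + 1 : ℕ) : ℂ) ≠ 0 := Nat.cast_ne_zero.2 (Nat.succ_ne_zero k)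
  refine mul_left_cancel₀ h4 ?_
  linear_combination h3

theorem Rep.mat_seqU (β : Rep p q) (U : Cl p q) {k : ℕ} (hk : k < dimN p q) :
    β.mat (seqU U (k + 1)) = β.mat U * (β.mat U).charpolyHorner k := by
  induction k with
  | zero => simp [seqU, Matrix.charpolyHorner]
  | succ k ih =>
    have hk' : k < dimN p q := by omega
    rw [seqU_succ U (Nat.succ_pos k), ← β.matHom_apply, map_mul, map_sub, β.matHom_apply,
      β.matHom_apply, β.matHom_apply, ih hk', β.mat_algebraMap,
      β.seqC_eq_of_mat_seqU U hk' (ih hk'), Matrix.charpolyHorner_succ, card_dimN, neg_smul,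
      sub_neg_eq_add]

theorem Rep.charCoeff_eq (β : Rep p q) (U : Cl p q) {k : ℕ} (h1 : 1 ≤ k) (hk : k ≤ dimN p q) :
    β.charCoeff U k = (seqC U k : ℂ) := by
  obtain ⟨k, rfl⟩ := Nat.exists_eq_add_of_le' h1
  rw [β.seqC_eq_of_mat_seqU U hk (β.mat_seqU U hk), Rep.charCoeff]

theorem Rep.det_eq (β : Rep p q) (hn : 1 ≤ p + q) (U : Cl p q) :
    β.Det U = ((-seqC U (dimN p q) : ℝ) : ℂ) := by
  rw [Complex.ofReal_neg, ← β.charCoeff_eq U (one_le_two.trans (two_le_dimN hn)) le_rfl, Rep.charCoeff,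
    neg_neg, Rep.Det, Matrix.det_eq_sign_charpoly_coeff, card_dimN, (even_dimN hn).neg_one_pow, one_mul,
    Nat.sub_self]

/-- `H_{N-1} = adj(-M) = (-1)^{N-1} adj M`, and `N - 1` is odd. -/
theorem Rep.mat_adj (β : Rep p q) (hn : 1 ≤ p + q) (U : Cl p q) :
    β.mat (algebraMap ℝ (Cl p q) (seqC U (dimN p q - 1)) - seqU U (dimN p q - 1)) =
      (β.mat U).adjugate := by
  have heven := even_dimN hn
  obtain ⟨m, hm⟩ := Nat.exists_eq_add_of_le' (two_le_dimN hn)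
  have hodd : Odd (dimN p q - 1) := by grind
  have hne : Nonempty (Fin (2 ^ ((p + q) / 2)) × Fin ((p + q) % 2 + 1)) := by
    rw [← Fintype.card_pos_iff, card_dimN]
    omega
  have h1 := (β.mat U).adjugate_neg_eq_charpolyHorner
  rw [card_dimN, hm, show m + 2 - 1 = m + 1 by omega, Matrix.charpolyHorner_succ, card_dimN,
    ← neg_one_smul ℂ (β.mat U), Matrix.adjugate_smul, card_dimN,
    hodd.neg_one_pow, neg_one_smul] at h1
  rw [hm, show m + 2 - 1 = m + 1 by omega, ← β.matHom_apply, map_sub, β.matHom_apply,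
    β.matHom_apply, β.mat_algebraMap, β.mat_seqU U (by omega),
    β.seqC_eq_of_mat_seqU U (by omega) (β.mat_seqU U (by omega)), ← neg_eq_iff_eq_neg.2 h1.symm]
  rw [neg_smul]
  abel

theorem Rep.algebraMap_seqC (β : Rep p q) (hn : 1 ≤ p + q) (U : Cl p q) :
    algebraMap ℝ (Cl p q) (-seqC U (dimN p q)) =
      U * (algebraMap ℝ (Cl p q) (seqC U (dimN p q - 1)) - seqU U (dimN p q - 1)) := by
  refine β.mat_injective ?_
  rw [β.mat_algebraMap, ← β.det_eq hn U, ← β.matHom_apply (U * _), map_mul, β.matHom_apply,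
    β.matHom_apply, β.mat_adj hn, Matrix.mul_adjugate, Rep.Det]

theorem Rep.isAdj (β : Rep p q) (hn : 1 ≤ p + q) (U : Cl p q) :
    β.IsAdj U (algebraMap ℝ (Cl p q) (seqC U (dimN p q - 1)) - seqU U (dimN p q - 1)) := by
  refine ⟨β.mat_adj hn U, -seqC U (dimN p q), (β.det_eq hn U).symm, ?_,
    (β.algebraMap_seqC hn U).symm⟩
  refine β.mat_injective ?_
  rw [β.mat_algebraMap, ← β.det_eq hn U, ← β.matHom_apply, map_mul, β.matHom_apply,
    β.matHom_apply, β.mat_adj hn, Matrix.adjugate_mul, Rep.Det]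

/-! ### Bell polynomial formulas -/

theorem seqU_eq_sum (U : Cl p q) (m : ℕ) :
    seqU U (m + 1) = U ^ (m + 1) - ∑ i ∈ Finset.range m, seqC U (i + 1) • U ^ (m - i) := by
  induction m with
  | zero => simp [seqU]
  | succ m ih =>
    rw [seqU_succ U (Nat.succ_pos m), ih, mul_sub, mul_sub, ← pow_succ', Finset.mul_sum,
      Finset.sum_range_succ, Algebra.algebraMap_eq_smul_one, mul_smul_comm, mul_one,
      Nat.add_sub_cancel_left, pow_one, sub_sub]
    congr 2
    refine Finset.sum_congr rfl fun i hi => ?_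
    rw [mul_smul_comm, ← pow_succ', Nat.sub_add_comm (Finset.mem_range.1 hi).le]

/-- Newton's identities: `k C_{(k)} = N⟨U^k⟩₀ - ∑ C_{(k-i)} N⟨U^i⟩₀`, summed over `0 < i < k`. The
signs and factorials in `seqS` convert this to `bell_succ`; no representation enters. -/
theorem bell_seqS (U : Cl p q) {k : ℕ} (hk : 1 ≤ k) :
    bell k (seqS U) = (-1) ^ (k + 1) * (k ! : ℝ) * seqC U k := by
  induction k using Nat.strong_induction_on with
  | _ k ih =>
    obtain ⟨m, rfl⟩ := Nat.exists_eq_add_of_le' hk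
    have h1 : scalarPart p q (seqU U (m + 1)) = scalarPart p q (U ^ (m + 1)) -
        ∑ i ∈ Finset.range m, seqC U (m - i) * scalarPart p q (U ^ (i + 1)) := by
      rw [seqU_eq_sum, map_sub, map_sum, ← Finset.sum_range_reflect]
      congr 1
      refine Finset.sum_congr rfl fun i hi => ?_
      rw [Finset.mem_range] at hi
      rw [map_smul, smul_eq_mul, show m - 1 - i + 1 = m - i by omega,
        show m - (m - 1 - i) = i + 1 by omega]
    have h2 := mul_seqC U hk
    rw [h1] at h2
    rw [Nat.factorial_succ, Nat.cast_mul,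
      show (-1 : ℝ) ^ (m + 1 + 1) * (((m + 1 : ℕ) : ℝ) * (m ! : ℝ)) * seqC U (m + 1) =
        (-1) ^ m * (m ! : ℝ) * (((m + 1 : ℕ) : ℝ) * seqC U (m + 1)) by ring, h2,
      bell_succ, Finset.sum_range_succ, Nat.sub_self, bell_zero, Nat.choose_self, seqS,
      Nat.add_sub_cancel, mul_sub, mul_sub, Finset.mul_sum, Finset.mul_sum, sub_eq_add_neg,
      ← Finset.sum_neg_distrib, add_comm]
    congr 1
    · push_cast
      ring
    · refine Finset.sum_congr rfl fun i hi => ?_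
      rw [Finset.mem_range] at hi
      rw [ih (m - i) (by omega) (by omega), seqS, Nat.add_sub_cancel,
        ← Nat.choose_mul_factorial_mul_factorial hi.le]
      have h3 : (-1 : ℝ) ^ m = (-1) ^ i * (-1) ^ (m - i) := by
        rw [← pow_add, Nat.add_sub_cancel' hi.le]
      rw [h3]
      push_cast
      ring

theorem seqC_eq_bell (U : Cl p q) {k : ℕ} (hk : 1 ≤ k) :
    seqC U k = (-1) ^ (k + 1) / (k ! : ℝ) * bell k (seqS U) := by
  have h : ((-1 : ℝ) ^ (k + 1)) * (-1) ^ (k + 1) = 1 := by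
    rw [← mul_pow]
    norm_num
  have : (k ! : ℝ) ≠ 0 := by positivity
  rw [bell_seqS U hk]
  field_simp
  linear_combination (-seqC U k) * h

theorem sum_bell_smul_pow (hn : 1 ≤ p + q) (U : Cl p q) :
    ∑ k ∈ Finset.range (dimN p q), ((-1) ^ (dimN p q + k - 1) / (k ! : ℝ) *
        bell k (seqS U)) • U ^ (dimN p q - k - 1) =
      algebraMap ℝ (Cl p q) (seqC U (dimN p q - 1)) - seqU U (dimN p q - 1) := by
  have heven := even_dimN hn
  obtain ⟨m, hm⟩ := Nat.exists_eq_add_of_le' (two_le_dimN hn)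
  rw [hm] at heven ⊢
  have hm1 : Odd (m + 1) := by grind
  -- As `N` is even, the term `k = 0` is `-U^{N-1}` and the last one is `C_{(N-1)}`; the others are
  -- the lower powers in `seqU_eq_sum`.
  rw [Finset.sum_range_succ', show m + 2 - 1 = m + 1 by omega, seqU_eq_sum, sub_eq_add_neg,
    neg_sub, sub_eq_add_neg, ← add_assoc]
  congr 1
  · rw [Finset.sum_range_succ, add_comm]
    congr 1
    · rw [Algebra.algebraMap_eq_smul_one, seqC_eq_bell U (Nat.succ_pos m)]
      rw [show m + 2 + (m + 1) - 1 = m + 1 + 1 + m by omega, pow_add _ _ m,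
        show m + 2 - (m + 1) - 1 = 0 by omega, pow_zero]
      have hme : Even m := by grind
      rw [hme.neg_one_pow, mul_one]
    · refine Finset.sum_congr rfl fun i hi => ?_
      rw [Finset.mem_range] at hi
      rw [seqC_eq_bell U (Nat.succ_pos i), show m + 2 + (i + 1) - 1 = m + 2 + i by omega,
        show m + 2 - (i + 1) - 1 = m - i by omega, pow_add, heven.neg_one_pow,
        pow_add _ (i + 1), pow_succ]
      simp
  · simp [bell_zero, hm1.neg_one_pow]

end Clifford

end

theorem mainTheorem1 (p q : ℕ) (hn : 1 ≤ p + q) :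
    Nonempty (Clifford.Rep p q) ∧
    (∀ (β : Clifford.Rep p q) (U : Clifford.Cl p q),
      -- the recursively defined scalars are the characteristic polynomial coefficients
      (∀ k : ℕ, 1 ≤ k → k ≤ Clifford.dimN p q →
        β.charCoeff U k = ((Clifford.seqC U k : ℝ) : ℂ)) ∧
      -- the determinant
      β.Det U = ((-Clifford.seqC U (Clifford.dimN p q) : ℝ) : ℂ) ∧
      algebraMap ℝ (Clifford.Cl p q) (-Clifford.seqC U (Clifford.dimN p q)) =
        -Clifford.seqU U (Clifford.dimN p q) ∧
      algebraMap ℝ (Clifford.Cl p q) (-Clifford.seqC U (Clifford.dimN p q)) =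
        U * (algebraMap ℝ (Clifford.Cl p q) (Clifford.seqC U (Clifford.dimN p q - 1)) -
          Clifford.seqU U (Clifford.dimN p q - 1)) ∧
      -- the adjugate
      β.IsAdj U
        (algebraMap ℝ (Clifford.Cl p q) (Clifford.seqC U (Clifford.dimN p q - 1)) -
          Clifford.seqU U (Clifford.dimN p q - 1)) ∧
      -- the formulas with complete Bell polynomials
      (∀ k : ℕ, 1 ≤ k → k ≤ Clifford.dimN p q →
        Clifford.seqC U k =
          (-1) ^ (k + 1) / (Nat.factorial k : ℝ) * Clifford.bell k (Clifford.seqS U)) ∧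
      β.Det U =
        ((1 / (Nat.factorial (Clifford.dimN p q) : ℝ) *
          Clifford.bell (Clifford.dimN p q) (Clifford.seqS U) : ℝ) : ℂ) ∧
      β.IsAdj U
        (∑ k ∈ Finset.range (Clifford.dimN p q),
          ((-1) ^ (Clifford.dimN p q + k - 1) / (Nat.factorial k : ℝ) *
            Clifford.bell k (Clifford.seqS U)) • U ^ (Clifford.dimN p q - k - 1))) ∧
    -- the two descriptions of the complete Bell polynomials agree
    (∀ (k : ℕ) (x : ℕ → ℝ), Clifford.bell k x = (Clifford.bellMatrix k x).det) := by
  have h2 := Clifford.two_le_dimN hn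
  refine ⟨Clifford.nonempty_rep p q, fun β U => ⟨fun k h1 hk => β.charCoeff_eq U h1 hk,
    β.det_eq hn U, ?_, β.algebraMap_seqC hn U, β.isAdj hn U,
    fun k h1 _ => Clifford.seqC_eq_bell U h1, ?_, ?_⟩, Clifford.bell_eq_det_bellMatrix⟩
  -- By the recursion `U (C_{(N-1)} - U_{(N-1)})` is `-U_{(N)}`.
  · rw [β.algebraMap_seqC hn U, ← neg_sub (Clifford.seqU U _), mul_neg,
      ← Clifford.seqU_succ U (by omega), Nat.sub_add_cancel (by omega)]
  · rw [β.det_eq hn U, Clifford.seqC_eq_bell U (by omega),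
      (Clifford.even_dimN hn).add_one.neg_one_pow]
    push_cast
    ring
  · rw [Clifford.sum_bell_smul_pow hn U]
    exact β.isAdj hn U
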